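/- **Theorem 4.4.** Let $G$ be a $3$-dimensional (real, smooth) Lie group with Lie algebra $\mathfrak g$, let $g$ be a left-invariant Riemannian metric on $G$, and fix an orientation of $\mathfrak g$. Let $(e_1,e_2,e_3)$ be a positively oriented $g$-orthonormal basis of $\mathfrak g$, also regarded as a left-invariant frame of $TG$. Let $\Sigma=\Lambda^\bullet L'\cong\mathbb C^2$, with $L'=\mathbb C\,y_1$, be the complex spinor module, with basis $(1,y_1)$, on which $e_1,e_2,e_3$ act by Clifford multiplication as $$\begin{pmatrix} i&0\\0&-i\end{pmatrix},\qquad \begin{pmatrix}0&i\\ i&0\end{pmatrix},\qquad \begin{pmatrix}0&-1\\1&0\end{pmatrix}.$$ The spinor bundle of the $G$-invariant spin structure of $(G,g)$ is the trivial bundle $G\times\Sigma$, with Clifford multiplication $X\cdot\phi=\sum_i g(X,e_i)\,e_i\cdot\phi$ and with the spin connection $$\widetilde\nabla_X\psi = d\psi(X)+\tfrac12\sum_{i<j} g(\nabla_X e_i,e_j)\,e_i\cdot e_j\cdot\psi ,$$ where $\nabla$ is the Levi-Civita connection of $g$. A spinor $\psi\colon G\to\Sigma$ is called invariant if $\psi(a^{-1}x)=\psi(x)$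 for all $a,x\in G$. A smooth spinor $\psi$ is called a generalised Killing spinor with endomorphism $A$ if $A$ is a smooth $g$-symmetric field of endomorphisms of $TG$ with $\widetilde\nabla_X\psi=A(X)\cdot\psi$ for every tangent vector $X$. Suppose that $\psi$ is an invariant generalised Killing spinor with endomorphism $A$ and that $\psi$ is not identically zero. Then $A$ commutes with the Ricci endomorphism of $g$, $\mathrm{Ric}(X)=\sum_j R(X,e_j)e_j$, that is, $A_x\circ \mathrm{Ric}_x=\mathrm{Ric}_x\circ A_x$ on $T_xG$ for every $x\in G$. -/

import Mathlib

open Bundle VectorField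
open scoped Manifold ContDiff

noncomputable section

set_option linter.unusedSectionVars false

/-! ### The Levi-Civita connection of a Riemannian metric -/

section LeviCivita

variable {E : Type*} [NormedAddCommGroup E] [NormedSpace ℝ E] {H : Type*} [TopologicalSpace H]
  {I : ModelWithCorners ℝ E H} {M : Type*} [TopologicalSpace M] [ChartedSpace H M]
  [IsManifold I ∞ M]
  (g : ContMDiffRiemannianMetric I ∞ E (fun x : M ↦ TangentSpace I x))

/-- The right-hand side of the Koszul formula for `2 g(∇_X Y, Z)`. -/
def koszul (X Y Z : Π x : M, TangentSpace I x) (x : M) : ℝ :=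
  mvfderiv I (fun y ↦ g.inner y (Y y) (Z y)) x (X x)
    + mvfderiv I (fun y ↦ g.inner y (X y) (Z y)) x (Y x)
    - mvfderiv I (fun y ↦ g.inner y (X y) (Y y)) x (Z x)
    + g.inner x (mlieBracket I X Y x) (Z x)
    - g.inner x (mlieBracket I X Z x) (Y x)
    - g.inner x (mlieBracket I Y Z x) (X x)

variable {g}

theorem mdifferentiableAt_metric {X Y : Π x : M, TangentSpace I x} {x : M}
    (hX : MDiffAt (T% X) x) (hY : MDiffAt (T% Y) x) :
    MDiffAt (fun y ↦ g.inner y (X y) (Y y)) x := by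
  have : MDifferentiableAt I (I.prod 𝓘(ℝ, ℝ))
      (fun m ↦ TotalSpace.mk' ℝ (E := Bundle.Trivial M ℝ) m (g.inner m (X m) (Y m))) x := by
    apply MDifferentiableAt.clm_bundle_apply₂ (F₁ := E) (F₂ := E)
    · exact g.contMDiff.mdifferentiableAt (by simp)
    · exact hX
    · exact hY
  simp only [mdifferentiableAt_totalSpace] at this
  exact this.2

theorem tangent_ext_of_metric {x : M} {v w : TangentSpace I x}
    (h : ∀ u, g.inner x v u = g.inner x w u) : v = w := by
  by_contra hne
  have := g.pos x (v - w) (sub_ne_zero.2 hne)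
  simp [h] at this

variable [FiniteDimensional ℝ E]

theorem koszul_tensorial_right {X Y : Π x : M, TangentSpace I x} {x : M}
    (hX : MDiffAt (T% X) x) (hY : MDiffAt (T% Y) x) :
    TensorialAt I E (fun Z ↦ koszul g X Y Z x) x where
  smul {f Z} hf hZ := by
    simp [koszul, mlieBracket_smul_right hf hZ,
      mvfderiv_fun_mul hf (mdifferentiableAt_metric (g := g) hX hZ),
      mvfderiv_fun_mul hf (mdifferentiableAt_metric (g := g) hY hZ)]
    rw [g.symm x (Z x), g.symm x (Z x)]
    ring
  add {Z Z'} hZ hZ' := by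
    simp [koszul, mlieBracket_add_right hZ hZ',
      mvfderiv_fun_add (mdifferentiableAt_metric (g := g) hX hZ)
        (mdifferentiableAt_metric (g := g) hX hZ'),
      mvfderiv_fun_add (mdifferentiableAt_metric (g := g) hY hZ)
        (mdifferentiableAt_metric (g := g) hY hZ')]
    ring

theorem koszul_tensorial_left {Y Z : Π x : M, TangentSpace I x} {x : M}
    (hY : MDiffAt (T% Y) x) (hZ : MDiffAt (T% Z) x) :
    TensorialAt I E (fun X ↦ koszul g X Y Z x) x where
  smul {f X} hf hX := by
    simp [koszul, mlieBracket_smul_left hf hX,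
      mvfderiv_fun_mul hf (mdifferentiableAt_metric (g := g) hX hZ),
      mvfderiv_fun_mul hf (mdifferentiableAt_metric (g := g) hX hY)]
    ring
  add {X X'} hX hX' := by
    simp [koszul, mlieBracket_add_left hX hX',
      mvfderiv_fun_add (mdifferentiableAt_metric (g := g) hX hZ)
        (mdifferentiableAt_metric (g := g) hX' hZ),
      mvfderiv_fun_add (mdifferentiableAt_metric (g := g) hX hY)
        (mdifferentiableAt_metric (g := g) hX' hY)]
    ring

theorem koszul_add {X Y Y' Z : Π x : M, TangentSpace I x} {x : M}
    (hX : MDiffAt (T% X) x) (hY : MDiffAt (T% Y) x) (hY' : MDiffAt (T% Y') x)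
    (hZ : MDiffAt (T% Z) x) :
    koszul g X (Y + Y') Z x = koszul g X Y Z x + koszul g X Y' Z x := by
  simp [koszul, mlieBracket_add_left hY hY', mlieBracket_add_right hY hY',
    mvfderiv_fun_add (mdifferentiableAt_metric (g := g) hY hZ)
      (mdifferentiableAt_metric (g := g) hY' hZ),
    mvfderiv_fun_add (mdifferentiableAt_metric (g := g) hX hY)
      (mdifferentiableAt_metric (g := g) hX hY')]
  ring

theorem koszul_leibniz {X Y Z : Π x : M, TangentSpace I x} {f : M → ℝ} {x : M}
    (hf : MDiffAt f x) (hX : MDiffAt (T% X) x) (hY : MDiffAt (T% Y) x) (hZ : MDiffAt (T% Z) x) :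
    koszul g X (f • Y) Z x =
      f x * koszul g X Y Z x + 2 * (mvfderiv I f x (X x) * g.inner x (Y x) (Z x)) := by
  simp [koszul, mlieBracket_smul_left hf hY, mlieBracket_smul_right hf hY,
    mvfderiv_fun_mul hf (mdifferentiableAt_metric (g := g) hX hY),
    mvfderiv_fun_mul hf (mdifferentiableAt_metric (g := g) hY hZ)]
  rw [g.symm x (Y x) (X x)]
  ring

theorem metric_nondegenerate (g : ContMDiffRiemannianMetric I ∞ E (fun x : M ↦ TangentSpace I x))
    (x : M) : (ContinuousLinearMap.toBilinForm (g.inner x)).Nondegenerate := by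
  have h : ∀ v : TangentSpace I x, (∀ w, g.inner x v w = 0) → v = 0 := fun v hv ↦
    tangent_ext_of_metric (g := g) fun u ↦ by simpa using hv u
  exact ⟨fun v hv ↦ h v hv, fun v hv ↦ h v fun w ↦ (g.symm x v w).trans (hv w)⟩

/-- The isomorphism `T_xM ≃ (T_xM)*`, `v ↦ g_x(v, ·)`, given by the metric. -/
def metricDual (g : ContMDiffRiemannianMetric I ∞ E (fun x : M ↦ TangentSpace I x)) (x : M) :
    TangentSpace I x ≃ₗ[ℝ] Module.Dual ℝ (TangentSpace I x) :=
  haveI : FiniteDimensional ℝ (TangentSpace I x) := inferInstanceAs (FiniteDimensional ℝ E)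
  LinearMap.BilinForm.toDual (ContinuousLinearMap.toBilinForm (g.inner x))
    (metric_nondegenerate g x)

theorem metricDual_symm_apply (g : ContMDiffRiemannianMetric I ∞ E (fun x : M ↦ TangentSpace I x))
    (x : M) (φ : Module.Dual ℝ (TangentSpace I x)) (w : TangentSpace I x) :
    g.inner x ((metricDual g x).symm φ) w = φ w :=
  haveI : FiniteDimensional ℝ (TangentSpace I x) := inferInstanceAs (FiniteDimensional ℝ E)
  LinearMap.BilinForm.apply_toDual_symm_apply
    (B := ContinuousLinearMap.toBilinForm (g.inner x)) (hB := metric_nondegenerate g x) φ w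

/-- The bilinear form `(v, w) ↦ 2 g(∇_v Y, w)` on `T_xM`, for `Y` differentiable at `x`. -/
def koszulForm (g : ContMDiffRiemannianMetric I ∞ E (fun x : M ↦ TangentSpace I x))
    {Y : Π x : M, TangentSpace I x} {x : M} (hY : MDiffAt (T% Y) x) :
    TangentSpace I x →L[ℝ] TangentSpace I x →L[ℝ] ℝ :=
  TensorialAt.mkHom₂ (fun X Z ↦ koszul g X Y Z x) x
    (fun _ hZ ↦ koszul_tensorial_left hY hZ) (fun _ hX ↦ koszul_tensorial_right hX hY)

open Classical in
/-- The map `v ↦ ∇_v Y` on `T_xM` determined by the Koszul formula. (As for `fderiv`, the value is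
`0` by convention if `Y` is not differentiable at `x`.) -/
def leviCivitaFun (g : ContMDiffRiemannianMetric I ∞ E (fun x : M ↦ TangentSpace I x))
    (Y : Π x : M, TangentSpace I x) (x : M) : TangentSpace I x →L[ℝ] TangentSpace I x :=
  haveI : FiniteDimensional ℝ (TangentSpace I x) := inferInstanceAs (FiniteDimensional ℝ E)
  haveI : T2Space (TangentSpace I x) := inferInstanceAs (T2Space E)
  if hY : MDiffAt (T% Y) x then
    LinearMap.toContinuousLinearMap
      ((metricDual g x).symm.toLinearMap ∘ₗ
        ((1 / 2 : ℝ) • ContinuousLinearMap.toBilinForm (koszulForm g hY)))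
  else 0

theorem inner_leviCivitaFun {X Y Z : Π x : M, TangentSpace I x} {x : M}
    (hX : MDiffAt (T% X) x) (hY : MDiffAt (T% Y) x) (hZ : MDiffAt (T% Z) x) :
    g.inner x (leviCivitaFun g Y x (X x)) (Z x) = koszul g X Y Z x / 2 := by
  have h : g.inner x (leviCivitaFun g Y x (X x)) (Z x) =
      (1 / 2) * koszulForm g hY (X x) (Z x) := by
    rw [leviCivitaFun, dif_pos hY]
    exact metricDual_symm_apply g x _ _
  rw [h, koszulForm, TensorialAt.mkHom₂_apply _ _ hX hZ]
  ring

theorem tangent_ext_of_fields {x : M} {v w : TangentSpace I x}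
    (h : ∀ Z : Π x : M, TangentSpace I x, MDiffAt (T% Z) x →
      g.inner x v (Z x) = g.inner x w (Z x)) : v = w :=
  tangent_ext_of_metric (g := g) fun u ↦ by
    simpa using h (FiberBundle.extend E u) (FiberBundle.mdifferentiableAt_extend I E u)

/-- The Levi-Civita connection of a Riemannian metric `g`, built from the Koszul formula.
`leviCivita g Y x v` is `∇_v Y`. -/
def leviCivita (g : ContMDiffRiemannianMetric I ∞ E (fun x : M ↦ TangentSpace I x)) :
    CovariantDerivative I E (fun x : M ↦ TangentSpace I x) where
  toFun := leviCivitaFun g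
  isCovariantDerivativeOnUniv := by
    constructor
    · intro Y Y' x hY hY' _
      ext v
      refine tangent_ext_of_fields (g := g) fun Z hZ ↦ ?_
      have hX := FiberBundle.mdifferentiableAt_extend I E v
      have e : FiberBundle.extend E v x = v := by simp
      rw [← e]
      simp only [_root_.add_apply, map_add]
      rw [inner_leviCivitaFun hX (mdifferentiableAt_add_section hY hY') hZ,
        inner_leviCivitaFun hX hY hZ, inner_leviCivitaFun hX hY' hZ, koszul_add hX hY hY' hZ]
      ring
    · intro Y f x hY hf _
      ext v
      refine tangent_ext_of_fields (g := g) fun Z hZ ↦ ?_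
      have hX := FiberBundle.mdifferentiableAt_extend I E v
      have e : FiberBundle.extend E v x = v := by simp
      rw [← e]
      simp only [_root_.add_apply, map_add, _root_.smul_apply, map_smul,
        ContinuousLinearMap.smulRight_apply, smul_eq_mul]
      rw [inner_leviCivitaFun hX (hf.smul_section hY) hZ, inner_leviCivitaFun hX hY hZ,
        koszul_leibniz hf hX hY hZ]
      ring

theorem inner_leviCivita {X Y Z : Π x : M, TangentSpace I x} {x : M}
    (hX : MDiffAt (T% X) x) (hY : MDiffAt (T% Y) x) (hZ : MDiffAt (T% Z) x) :
    g.inner x (leviCivita g Y x (X x)) (Z x) = koszul g X Y Z x / 2 :=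
  inner_leviCivitaFun hX hY hZ

/-- The Levi-Civita connection is metric. -/
theorem leviCivita_metric {X Y Z : Π x : M, TangentSpace I x} {x : M}
    (hX : MDiffAt (T% X) x) (hY : MDiffAt (T% Y) x) (hZ : MDiffAt (T% Z) x) :
    mvfderiv I (fun y ↦ g.inner y (Y y) (Z y)) x (X x) =
      g.inner x (leviCivita g Y x (X x)) (Z x) + g.inner x (Y x) (leviCivita g Z x (X x)) := by
  rw [g.symm x (Y x), inner_leviCivita hX hY hZ, inner_leviCivita hX hZ hY]
  have h : (fun y ↦ g.inner y (Z y) (Y y)) = fun y ↦ g.inner y (Y y) (Z y) :=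
    funext fun y ↦ g.symm y _ _
  have h1 : mlieBracket I Z Y x = - mlieBracket I Y Z x := mlieBracket_swap_apply
  simp only [koszul, h, h1, map_neg, _root_.neg_apply]
  ring

/-- The Levi-Civita connection is torsion-free: `∇_X Y - ∇_Y X = [X, Y]`. -/
theorem leviCivita_torsion_free {X Y : Π x : M, TangentSpace I x} {x : M}
    (hX : MDiffAt (T% X) x) (hY : MDiffAt (T% Y) x) :
    leviCivita g Y x (X x) - leviCivita g X x (Y x) = mlieBracket I X Y x := by
  refine tangent_ext_of_fields (g := g) fun Z hZ ↦ ?_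
  simp only [map_sub, _root_.sub_apply]
  rw [inner_leviCivita hX hY hZ, inner_leviCivita hY hX hZ]
  have h : (fun y ↦ g.inner y (Y y) (X y)) = fun y ↦ g.inner y (X y) (Y y) :=
    funext fun y ↦ g.symm y _ _
  have h1 : mlieBracket I Y X x = - mlieBracket I X Y x := mlieBracket_swap_apply
  simp only [koszul, h, h1, map_neg, _root_.neg_apply]
  ring

/-- The Riemann curvature tensor of the Levi-Civita connection, on vector fields:
`R(X, Y) Z = ∇_X ∇_Y Z - ∇_Y ∇_X Z - ∇_[X, Y] Z`. -/
def riemannCurvature (g : ContMDiffRiemannianMetric I ∞ E (fun x : M ↦ TangentSpace I x))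
    (X Y Z : Π x : M, TangentSpace I x) (x : M) : TangentSpace I x :=
  leviCivita g (fun y ↦ leviCivita g Z y (Y y)) x (X x)
    - leviCivita g (fun y ↦ leviCivita g Z y (X y)) x (Y x)
    - leviCivita g Z x (mlieBracket I X Y x)

end LeviCivita

/-! ### The spin representation in dimension three -/

/-- The three-dimensional spinor module `Σ = Λ L'`, with `L' = ℂ y₁`, identified with `ℂ²` by means
of its basis `(1, y₁)`. -/
abbrev SpinorModule : Type := Fin 2 → ℂ

/-- Clifford multiplication on `Σ` by the vectors `e₁, e₂, e₃` of a positively oriented orthonormal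
basis, in the basis `(1, y₁)`:
`e₁ · η = i (η_even - η_odd)`, `e₂ · η = i (x₁ ⌟ η + y₁ ∧ η)`, `e₃ · η = y₁ ∧ η - x₁ ⌟ η`. -/
def cliffordGen : Fin 3 → Matrix (Fin 2) (Fin 2) ℂ :=
  ![!![Complex.I, 0; 0, -Complex.I], !![0, Complex.I; Complex.I, 0], !![0, -1; 1, 0]]

/-- The Clifford relations `eᵢ eⱼ + eⱼ eᵢ = - 2 δᵢⱼ`. -/
theorem cliffordGen_mul_add (i j : Fin 3) :
    cliffordGen i * cliffordGen j + cliffordGen j * cliffordGen i =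
      if i = j then (-2 : Matrix (Fin 2) (Fin 2) ℂ) else 0 := by
  have h2 : (-2 : Matrix (Fin 2) (Fin 2) ℂ) = !![-2, 0; 0, -2] := by
    ext a b
    fin_cases a <;> fin_cases b <;> simp [Matrix.ofNat_apply]
  rw [h2]
  ext a b
  fin_cases i <;> fin_cases j <;> fin_cases a <;> fin_cases b <;>
    norm_num [cliffordGen, Matrix.mul_apply, Fin.sum_univ_two]

/-! ### Invariant generalised Killing spinors on three-dimensional Lie groups -/

section LieGroup

variable {E : Type*} [NormedAddCommGroup E] [NormedSpace ℝ E] {H : Type*} [TopologicalSpace H]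
  {I : ModelWithCorners ℝ E H} {G : Type*} [TopologicalSpace G] [ChartedSpace H G] [Group G]
  [IsManifold I ∞ G]

/-- The metric `g` on `G` is left-invariant: all left translations are isometries. -/
def IsLeftInvariantMetric (g : ContMDiffRiemannianMetric I ∞ E (fun x : G ↦ TangentSpace I x)) :
    Prop :=
  ∀ (a x : G) (v w : TangentSpace I x),
    g.inner (a * x) (mfderiv I I (fun y ↦ a * y) x v) (mfderiv I I (fun y ↦ a * y) x w)
      = g.inner x v w

/-- `e` is a `g`-orthonormal basis of the Lie algebra, positively oriented with respect to `o`. -/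
structure IsOrientedOrthonormal
    (g : ContMDiffRiemannianMetric I ∞ E (fun x : G ↦ TangentSpace I x))
    (o : Orientation ℝ (GroupLieAlgebra I G) (Fin 3))
    (e : Module.Basis (Fin 3) ℝ (GroupLieAlgebra I G)) : Prop where
  orthonormal : ∀ i j, g.inner (1 : G) (e i) (e j) = if i = j then 1 else 0
  orientation : e.orientation = o

/-- The left-invariant vector field on `G` with value `e i` at the identity. -/
def leftFrame (e : Module.Basis (Fin 3) ℝ (GroupLieAlgebra I G)) (i : Fin 3) (x : G) :
    TangentSpace I x :=
  mulInvariantVectorField (I := I) (e i) x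

/-- Clifford multiplication by the tangent vector `v ∈ T_xG` on the fibre `Σ` at `x` of the spinor
bundle `G × Σ`, which is trivialised by the orthonormal left-invariant frame given by `e`. -/
def cliffordMul (g : ContMDiffRiemannianMetric I ∞ E (fun x : G ↦ TangentSpace I x))
    (e : Module.Basis (Fin 3) ℝ (GroupLieAlgebra I G)) (x : G) (v : TangentSpace I x) :
    Matrix (Fin 2) (Fin 2) ℂ :=
  ∑ i, (g.inner x v (leftFrame e i x) : ℂ) • cliffordGen i

/-- The spin connection on the spinor bundle `G × Σ`, i.e. the lift of the Levi-Civita connection: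
`∇_v ψ = dψ(v) + (1/2) ∑_{i < j} g(∇_v eᵢ, eⱼ) eᵢ · eⱼ · ψ`. -/
def spinConnection [FiniteDimensional ℝ E]
    (g : ContMDiffRiemannianMetric I ∞ E (fun x : G ↦ TangentSpace I x))
    (e : Module.Basis (Fin 3) ℝ (GroupLieAlgebra I G)) (ψ : G → SpinorModule)
    (x : G) (v : TangentSpace I x) : SpinorModule :=
  mvfderiv I ψ x v +
    (1 / 2 : ℂ) • ∑ i, ∑ j ∈ Finset.Ioi i,
      (g.inner x (leviCivita g (leftFrame e i) x v) (leftFrame e j x) : ℂ) •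
        (cliffordGen i * cliffordGen j).mulVec (ψ x)

/-- A spinor `ψ : G → Σ` is invariant if it is fixed by the action `(a · ψ)(x) = ψ(a⁻¹ x)` of `G`. -/
def IsInvariantSpinor (ψ : G → SpinorModule) : Prop :=
  ∀ a : G, (fun x ↦ ψ (a⁻¹ * x)) = ψ

/-- `ψ` is a generalised Killing spinor with endomorphism (field) `A`: both are smooth, `A` is
`g`-symmetric, and `∇_X ψ = A(X) · ψ` for every tangent vector `X`. -/
structure IsGeneralisedKillingSpinor [FiniteDimensional ℝ E]
    (g : ContMDiffRiemannianMetric I ∞ E (fun x : G ↦ TangentSpace I x))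
    (e : Module.Basis (Fin 3) ℝ (GroupLieAlgebra I G)) (ψ : G → SpinorModule)
    (A : Π x : G, TangentSpace I x →L[ℝ] TangentSpace I x) : Prop where
  smooth_spinor : ContMDiff I 𝓘(ℝ, SpinorModule) ∞ ψ
  smooth_endomorphism : ContMDiff I (I.prod 𝓘(ℝ, E →L[ℝ] E)) ∞ (fun x ↦
    (TotalSpace.mk' (E →L[ℝ] E) x (A x) :
      TotalSpace (E →L[ℝ] E) (fun x : G ↦ TangentSpace I x →L[ℝ] TangentSpace I x)))
  symmetric : ∀ (x : G) (v w : TangentSpace I x), g.inner x (A x v) w = g.inner x v (A x w)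
  killing : ∀ (x : G) (v : TangentSpace I x),
    spinConnection g e ψ x v = (cliffordMul g e x (A x v)).mulVec (ψ x)

/-- The Ricci endomorphism of `g` at `x`: the linear endomorphism of `T_xG` with
`Ric(X) = ∑ⱼ R(X, eⱼ) eⱼ`, computed in the orthonormal left-invariant frame given by `e`. (Since `R`
is a tensor, the result does not depend on the choice of the orthonormal frame.) -/
def ricciEndomorphism [FiniteDimensional ℝ E]
    (g : ContMDiffRiemannianMetric I ∞ E (fun x : G ↦ TangentSpace I x))
    (e : Module.Basis (Fin 3) ℝ (GroupLieAlgebra I G)) (x : G) :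
    TangentSpace I x →L[ℝ] TangentSpace I x :=
  ∑ i, (g.inner x (leftFrame e i x)).smulRight
    (∑ j, riemannCurvature g (leftFrame e i) (leftFrame e j) (leftFrame e j) x)

end LieGroup

end

/-! ### Left-invariant fields and orthonormal frames -/

section LeftInvariant

variable {E : Type*} [NormedAddCommGroup E] [NormedSpace ℝ E]
  {G : Type*} [TopologicalSpace G] [ChartedSpace E G] [Group G] [LieGroup 𝓘(ℝ, E) ∞ G]
  {g : ContMDiffRiemannianMetric 𝓘(ℝ, E) ∞ E (fun x : G ↦ TangentSpace 𝓘(ℝ, E) x)}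

/-! The endomorphism determines the connection, and `Ric` is then a polynomial in `A`. An invariant
spinor is constant, so only the connection term of the Killing equation survives. In dimension three
a product of two distinct Clifford generators is, up to sign, the third
(`sum_smul_cliffordGen_mul_mulVec`), so this term is Clifford multiplication of `ψ` by a real
vector. A nonzero real vector acts invertibly (`eq_zero_of_sum_cliffordGen_mulVec`), so that vector
must be `A(X)`. Hence `Γᵢⱼₖ = 2 ∑ₗ εⱼₖₗ aᵢₗ`, that is, `∇_X Y = 2 A(X) × Y` for left-invariant `Y`
(`frameChristoffel_of_killing`).

Torsion-freeness gives `[X, Y] = 2 (AX × Y + X × AY) = 2 (t - A)(X × Y)`, where `t = tr A` and `A`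
is symmetric. Moreover `AX × AY = (A² - tA + s)(X × Y)`, with `s` the second elementary symmetric
function of the eigenvalues. So `R(X, Y)Z = B(X × Y) × Z` with `B = 4 (2A² - 2tA + s)`, and tracing
gives `Ric = B - tr B = 8 (A² - tA + s)`, which commutes with `A`. The code checks the commutation
directly on matrix entries (`commute_ricci_of_christoffel`). -/

theorem lieGroup_minSmoothness_three (E G : Type*) [NormedAddCommGroup E] [NormedSpace ℝ E]
    [TopologicalSpace G] [ChartedSpace E G] [Group G] [LieGroup 𝓘(ℝ, E) ∞ G] :
    LieGroup 𝓘(ℝ, E) (minSmoothness ℝ 3) G := by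
  rw [minSmoothness_of_isRCLikeNormedField]
  infer_instance

theorem mdifferentiableAt_leftFrame (e : Module.Basis (Fin 3) ℝ (GroupLieAlgebra 𝓘(ℝ, E) G))
    (i : Fin 3) (x : G) : MDiffAt (T% (leftFrame e i)) x :=
  haveI := lieGroup_minSmoothness_three E G
  mdifferentiableAt_mulInvariantVectorField (e i)

/-- A left-invariant metric is constant on left-invariant vector fields. -/
theorem IsLeftInvariantMetric.inner_mulInvariantVectorField (hg : IsLeftInvariantMetric g)
    (u v : GroupLieAlgebra 𝓘(ℝ, E) G) (x : G) :
    g.inner x (mulInvariantVectorField u x) (mulInvariantVectorField v x)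
      = g.inner (1 : G) u v := by
  have h := hg x 1 u v
  -- Invariance under translation by `x` lands in the fibre over `x * 1`, which equals `x` only
  -- propositionally; a variable base point allows the fibres to be identified by substitution.
  have key : ∀ y (hy : y = x), g.inner y (mfderiv 𝓘(ℝ, E) 𝓘(ℝ, E) (fun y ↦ x * y) 1 u)
      (mfderiv 𝓘(ℝ, E) 𝓘(ℝ, E) (fun y ↦ x * y) 1 v) =
      g.inner x (mulInvariantVectorField u x) (mulInvariantVectorField v x) := by
    rintro y rfl
    rfl
  rw [← key (x * 1) (mul_one x)]
  exact h

theorem inner_leftFrame (hg : IsLeftInvariantMetric g)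
    {o : Orientation ℝ (GroupLieAlgebra 𝓘(ℝ, E) G) (Fin 3)}
    {e : Module.Basis (Fin 3) ℝ (GroupLieAlgebra 𝓘(ℝ, E) G)}
    (he : IsOrientedOrthonormal g o e) (i j : Fin 3) (x : G) :
    g.inner x (leftFrame e i x) (leftFrame e j x) = if i = j then 1 else 0 :=
  (hg.inner_mulInvariantVectorField (e i) (e j) x).trans (he.orthonormal i j)

/-- Expansion of a tangent vector in an orthonormal left-invariant frame. -/
theorem sum_inner_leftFrame (hg : IsLeftInvariantMetric g)
    {o : Orientation ℝ (GroupLieAlgebra 𝓘(ℝ, E) G) (Fin 3)}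
    {e : Module.Basis (Fin 3) ℝ (GroupLieAlgebra 𝓘(ℝ, E) G)}
    (he : IsOrientedOrthonormal g o e) (x : G) (v : TangentSpace 𝓘(ℝ, E) x) :
    ∑ i, g.inner x v (leftFrame e i x) • leftFrame e i x = v := by
  have hli : LinearIndependent ℝ (fun i ↦ leftFrame e i x) := by
    rw [Fintype.linearIndependent_iff]
    intro c hc i
    have := congrArg (fun w ↦ g.inner x w (leftFrame e i x)) hc
    simpa [map_sum, inner_leftFrame hg he] using this
  -- Every tangent space is definitionally `E`, so the basis `e` at the identity also computes the
  -- dimension at `x`.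
  have hcard : Fintype.card (Fin 3) = Module.finrank ℝ (TangentSpace 𝓘(ℝ, E) x) :=
    (Module.finrank_eq_card_basis e).symm
  have : FiniteDimensional ℝ (TangentSpace 𝓘(ℝ, E) x) := e.finiteDimensional_of_finite
  have hmem : v ∈ Submodule.span ℝ (Set.range fun i ↦ leftFrame e i x) := by
    rw [hli.span_eq_top_of_card_eq_finrank' hcard]
    trivial
  obtain ⟨c, rfl⟩ := (Submodule.mem_span_range_iff_exists_fun ℝ).1 hmem
  simp [map_sum, inner_leftFrame hg he]

/-- Two tangent vectors with the same components in an orthonormal left-invariant frame agree. -/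
theorem ext_inner_leftFrame (hg : IsLeftInvariantMetric g)
    {o : Orientation ℝ (GroupLieAlgebra 𝓘(ℝ, E) G) (Fin 3)}
    {e : Module.Basis (Fin 3) ℝ (GroupLieAlgebra 𝓘(ℝ, E) G)}
    (he : IsOrientedOrthonormal g o e) {x : G} {v w : TangentSpace 𝓘(ℝ, E) x}
    (h : ∀ i, g.inner x v (leftFrame e i x) = g.inner x w (leftFrame e i x)) : v = w := by
  rw [← sum_inner_leftFrame hg he x v, ← sum_inner_leftFrame hg he x w]
  simp only [h]

/-! ### Connection and curvature in a left-invariant frame -/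

variable [FiniteDimensional ℝ E]

/-- Brackets of left-invariant fields are left-invariant, so an invariant metric gives them constant
components. -/
theorem inner_mlieBracket_leftFrame (hg : IsLeftInvariantMetric g)
    (e : Module.Basis (Fin 3) ℝ (GroupLieAlgebra 𝓘(ℝ, E) G)) (i j k : Fin 3) (x : G) :
    g.inner x (mlieBracket 𝓘(ℝ, E) (leftFrame e i) (leftFrame e j) x) (leftFrame e k x) =
      g.inner (1 : G) (mlieBracket 𝓘(ℝ, E) (leftFrame e i) (leftFrame e j) 1) (e k) := by
  have := lieGroup_minSmoothness_three E G
  have := FiniteDimensional.complete ℝ E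
  rw [← hg.inner_mulInvariantVectorField _ (e k) x]
  exact congrArg (fun w ↦ g.inner x w (leftFrame e k x))
    (congrFun (mulInvariantVector_mlieBracket (I := 𝓘(ℝ, E)) (e i) (e j)) x).symm

/-- The Christoffel symbols `g(∇_{eᵢ} eⱼ, eₖ)` of a left-invariant frame, at the identity. -/
noncomputable def frameChristoffel (g : ContMDiffRiemannianMetric 𝓘(ℝ, E) ∞ E
      (fun x : G ↦ TangentSpace 𝓘(ℝ, E) x))
    (e : Module.Basis (Fin 3) ℝ (GroupLieAlgebra 𝓘(ℝ, E) G)) (i j k : Fin 3) : ℝ :=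
  g.inner (1 : G) (leviCivita g (leftFrame e j) 1 (leftFrame e i 1)) (leftFrame e k 1)

/-- In the Koszul formula the derivative terms vanish, since the frame has constant inner products,
and the bracket terms do not depend on the point. -/
theorem inner_leviCivita_leftFrame (hg : IsLeftInvariantMetric g)
    {o : Orientation ℝ (GroupLieAlgebra 𝓘(ℝ, E) G) (Fin 3)}
    {e : Module.Basis (Fin 3) ℝ (GroupLieAlgebra 𝓘(ℝ, E) G)}
    (he : IsOrientedOrthonormal g o e) (i j k : Fin 3) (x : G) :
    g.inner x (leviCivita g (leftFrame e j) x (leftFrame e i x)) (leftFrame e k x) =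
      frameChristoffel g e i j k := by
  rw [frameChristoffel]
  have hd := fun l (y : G) ↦ mdifferentiableAt_leftFrame e l y
  rw [inner_leviCivita (hd _ _) (hd _ _) (hd _ _), inner_leviCivita (hd _ _) (hd _ _) (hd _ _)]
  simp only [koszul, inner_leftFrame hg he, mvfderiv_const, _root_.zero_apply,
    inner_mlieBracket_leftFrame hg e _ _ _ x, inner_mlieBracket_leftFrame hg e _ _ _ 1]

theorem frameChristoffel_antisymm (hg : IsLeftInvariantMetric g)
    {o : Orientation ℝ (GroupLieAlgebra 𝓘(ℝ, E) G) (Fin 3)}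
    {e : Module.Basis (Fin 3) ℝ (GroupLieAlgebra 𝓘(ℝ, E) G)}
    (he : IsOrientedOrthonormal g o e) (i j k : Fin 3) :
    frameChristoffel g e i k j = -frameChristoffel g e i j k := by
  have hd := fun l (y : G) ↦ mdifferentiableAt_leftFrame e l y
  have h := leviCivita_metric (g := g) (hd i 1) (hd j 1) (hd k 1)
  simp only [inner_leftFrame hg he, mvfderiv_const, _root_.zero_apply] at h
  rw [g.symm 1 (leftFrame e j 1)] at h
  simp only [frameChristoffel]
  linarith

theorem leviCivita_leftFrame (hg : IsLeftInvariantMetric g)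
    {o : Orientation ℝ (GroupLieAlgebra 𝓘(ℝ, E) G) (Fin 3)}
    {e : Module.Basis (Fin 3) ℝ (GroupLieAlgebra 𝓘(ℝ, E) G)}
    (he : IsOrientedOrthonormal g o e) (i j : Fin 3) (x : G) :
    leviCivita g (leftFrame e j) x (leftFrame e i x) =
      ∑ k, frameChristoffel g e i j k • leftFrame e k x := by
  rw [← sum_inner_leftFrame hg he x (leviCivita g (leftFrame e j) x (leftFrame e i x))]
  simp only [inner_leviCivita_leftFrame hg he]

/-- Covariant derivative of a left-invariant field, given by constant coefficients. -/
theorem leviCivita_sum_smul_leftFrame (hg : IsLeftInvariantMetric g)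
    {o : Orientation ℝ (GroupLieAlgebra 𝓘(ℝ, E) G) (Fin 3)}
    {e : Module.Basis (Fin 3) ℝ (GroupLieAlgebra 𝓘(ℝ, E) G)}
    (he : IsOrientedOrthonormal g o e) (c : Fin 3 → ℝ) (i : Fin 3) (x : G) :
    leviCivita g (fun y ↦ ∑ k, c k • leftFrame e k y) x (leftFrame e i x) =
      ∑ k, c k • ∑ l, frameChristoffel g e i k l • leftFrame e l x := by
  have hd := fun l ↦ mdifferentiableAt_leftFrame e l x
  have hs : ∀ l, MDiffAt (T% (c l • leftFrame e l)) x := fun l ↦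
    mdifferentiableAt_const.smul_section (f := fun _ ↦ c l) (hd l)
  have hcov := (leviCivita g).isCovariantDerivativeOn (s := Set.univ)
  have hfun : (fun y ↦ ∑ k, c k • leftFrame e k y) =
      c 0 • leftFrame e 0 + c 1 • leftFrame e 1 + c 2 • leftFrame e 2 := by
    funext y
    simp [Fin.sum_univ_three]
  rw [hfun, hcov.add (mdifferentiableAt_add_section (hs 0) (hs 1)) (hs 2), hcov.add (hs 0) (hs 1),
    hcov.smul_const _ (hd 0), hcov.smul_const _ (hd 1), hcov.smul_const _ (hd 2)]
  simp only [_root_.add_apply, _root_.smul_apply, leviCivita_leftFrame hg he]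
  rw [Fin.sum_univ_three (fun k ↦ c k • ∑ l, frameChristoffel g e i k l • leftFrame e l x)]

/-- The components `g(R(eᵢ, eⱼ) eₖ, eₘ)` in terms of Christoffel symbols `Γ`. -/
noncomputable def frameCurvature (Γ : Fin 3 → Fin 3 → Fin 3 → ℝ) (i j k m : Fin 3) : ℝ :=
  ∑ l, (Γ j k l * Γ i l m - Γ i k l * Γ j l m - (Γ i j l - Γ j i l) * Γ l k m)

theorem inner_riemannCurvature_leftFrame (hg : IsLeftInvariantMetric g)
    {o : Orientation ℝ (GroupLieAlgebra 𝓘(ℝ, E) G) (Fin 3)}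
    {e : Module.Basis (Fin 3) ℝ (GroupLieAlgebra 𝓘(ℝ, E) G)}
    (he : IsOrientedOrthonormal g o e) (i j k m : Fin 3) (x : G) :
    g.inner x (riemannCurvature g (leftFrame e i) (leftFrame e j) (leftFrame e k) x)
      (leftFrame e m x) = frameCurvature (frameChristoffel g e) i j k m := by
  have hd := fun l ↦ mdifferentiableAt_leftFrame e l x
  -- Torsion-freeness turns the bracket into `∇_{eᵢ} eⱼ - ∇_{eⱼ} eᵢ`, so structure constants never
  -- enter.
  rw [riemannCurvature, ← leviCivita_torsion_free (g := g) (hd i) (hd j)]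
  simp only [leviCivita_leftFrame hg he, leviCivita_sum_smul_leftFrame hg he, map_sub, map_sum,
    map_smul, _root_.sub_apply, sum_apply, _root_.smul_apply, smul_eq_mul,
    inner_leftFrame hg he, mul_ite, mul_one, mul_zero, Finset.sum_ite_eq', Finset.mem_univ, if_true,
    frameCurvature, Finset.sum_sub_distrib, sub_mul]

theorem inner_ricciEndomorphism_leftFrame (hg : IsLeftInvariantMetric g)
    {o : Orientation ℝ (GroupLieAlgebra 𝓘(ℝ, E) G) (Fin 3)}
    {e : Module.Basis (Fin 3) ℝ (GroupLieAlgebra 𝓘(ℝ, E) G)}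
    (he : IsOrientedOrthonormal g o e) (i m : Fin 3) (x : G) :
    g.inner x (ricciEndomorphism g e x (leftFrame e i x)) (leftFrame e m x) =
      ∑ j, frameCurvature (frameChristoffel g e) i j j m := by
  simp [ricciEndomorphism, inner_leftFrame hg he, map_sum, sum_apply,
    inner_riemannCurvature_leftFrame hg he]

end LeftInvariant

/-! ### Spinors in dimension three and the Killing equation -/

section Spinor

variable {E : Type*} [NormedAddCommGroup E] [NormedSpace ℝ E]
  {G : Type*} [TopologicalSpace G] [ChartedSpace E G] [Group G] [LieGroup 𝓘(ℝ, E) ∞ G]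

theorem IsInvariantSpinor.eq_const {G : Type*} [Group G] {ψ : G → SpinorModule}
    (h : IsInvariantSpinor ψ) : ψ = fun _ ↦ ψ 1 := by
  funext x
  simpa using (congrFun (h x) x).symm

/-- Clifford multiplication by a nonzero real vector is injective. -/
theorem eq_zero_of_sum_cliffordGen_mulVec {φ : SpinorModule} (hφ : φ ≠ 0) {v : Fin 3 → ℝ}
    (h : (∑ i, (v i : ℂ) • cliffordGen i).mulVec φ = 0) : v = 0 := by
  set M := ∑ i, (v i : ℂ) • cliffordGen i with hM
  -- The determinant is the squared length; because `v` is real, it vanishes only for `v = 0`.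
  have hdet : M.det = ((v 0 ^ 2 + v 1 ^ 2 + v 2 ^ 2 : ℝ) : ℂ) := by
    rw [hM, Matrix.det_fin_two]
    simp [Fin.sum_univ_three, cliffordGen]
    ring_nf
    simp [Complex.I_sq]
  have h0 : M.det = 0 := Matrix.exists_mulVec_eq_zero_iff.1 ⟨φ, hφ, h⟩
  rw [hdet, Complex.ofReal_eq_zero] at h0
  have h0' : v 0 = 0 ∧ v 1 = 0 ∧ v 2 = 0 := by
    refine ⟨?_, ?_, ?_⟩ <;> nlinarith [sq_nonneg (v 0), sq_nonneg (v 1), sq_nonneg (v 2)]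
  funext i
  fin_cases i
  exacts [h0'.1, h0'.2.1, h0'.2.2]

/-- Bivectors act as vectors: `e₀e₁ = e₂`, `e₀e₂ = -e₁` and `e₁e₂ = e₀` in this representation,
whence the sign in the middle component. -/
theorem sum_smul_cliffordGen_mul_mulVec (c : Fin 3 → Fin 3 → ℝ) (φ : SpinorModule) :
    ∑ i, ∑ j ∈ Finset.Ioi i, (c i j : ℂ) • (cliffordGen i * cliffordGen j).mulVec φ =
      (∑ i, ((![c 1 2, -c 0 2, c 0 1] i : ℝ) : ℂ) • cliffordGen i).mulVec φ := by
  have h0 : Finset.Ioi (0 : Fin 3) = {1, 2} := by decide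
  have h1 : Finset.Ioi (1 : Fin 3) = {2} := by decide
  have h2 : Finset.Ioi (2 : Fin 3) = ∅ := by decide
  have h01 : cliffordGen 0 * cliffordGen 1 = cliffordGen 2 := by
    ext a b; fin_cases a <;> fin_cases b <;> simp [cliffordGen, Matrix.mul_apply]
  have h02 : cliffordGen 0 * cliffordGen 2 = -cliffordGen 1 := by
    ext a b; fin_cases a <;> fin_cases b <;> simp [cliffordGen, Matrix.mul_apply]
  have h12 : cliffordGen 1 * cliffordGen 2 = cliffordGen 0 := by
    ext a b; fin_cases a <;> fin_cases b <;> simp [cliffordGen, Matrix.mul_apply]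
  rw [Fin.sum_univ_three, h0, h1, h2, Finset.sum_pair (by decide), h01, h02]
  simp only [Finset.sum_singleton, Finset.sum_empty, h12, Fin.sum_univ_three, Matrix.add_mulVec,
    Matrix.smul_mulVec, Matrix.neg_mulVec, Matrix.cons_val_zero, Matrix.cons_val_one,
    Matrix.cons_val, Complex.ofReal_neg]
  module

/-- For an invariant generalised Killing spinor the endomorphism determines the Christoffel
symbols. -/
theorem frameChristoffel_of_killing [FiniteDimensional ℝ E]
    {g : ContMDiffRiemannianMetric 𝓘(ℝ, E) ∞ E (fun x : G ↦ TangentSpace 𝓘(ℝ, E) x)}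
    (hg : IsLeftInvariantMetric g)
    {o : Orientation ℝ (GroupLieAlgebra 𝓘(ℝ, E) G) (Fin 3)}
    {e : Module.Basis (Fin 3) ℝ (GroupLieAlgebra 𝓘(ℝ, E) G)}
    (he : IsOrientedOrthonormal g o e)
    {ψ : G → SpinorModule} (hψ : ψ ≠ 0) (hinv : IsInvariantSpinor ψ)
    {A : Π x : G, TangentSpace 𝓘(ℝ, E) x →L[ℝ] TangentSpace 𝓘(ℝ, E) x}
    (hA : IsGeneralisedKillingSpinor g e ψ A) (x : G) (i : Fin 3) :
    frameChristoffel g e i 1 2 = 2 * g.inner x (A x (leftFrame e i x)) (leftFrame e 0 x) ∧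
    -frameChristoffel g e i 0 2 = 2 * g.inner x (A x (leftFrame e i x)) (leftFrame e 1 x) ∧
    frameChristoffel g e i 0 1 = 2 * g.inner x (A x (leftFrame e i x)) (leftFrame e 2 x) := by
  have hc := hinv.eq_const
  have h1 : ψ x ≠ 0 := by
    intro h
    refine hψ (funext fun y ↦ ?_)
    rw [hc] at h ⊢
    exact h
  have hk := hA.killing x (leftFrame e i x)
  have hmv : mvfderiv 𝓘(ℝ, E) ψ x = 0 := by rw [hc]; exact mvfderiv_const _
  simp only [spinConnection, hmv, _root_.zero_apply, zero_add,
    inner_leviCivita_leftFrame hg he] at hk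
  rw [sum_smul_cliffordGen_mul_mulVec (frameChristoffel g e i), cliffordMul] at hk
  set c : Fin 3 → ℝ := ![frameChristoffel g e i 1 2, -frameChristoffel g e i 0 2,
    frameChristoffel g e i 0 1] with hcdef
  -- Doubling the Killing equation clears the factor `1/2` of the spin connection; the real vector
  -- `c - 2 A(eᵢ)` then annihilates `ψ x`.
  have hz := eq_zero_of_sum_cliffordGen_mulVec h1
    (v := fun j ↦ c j - 2 * g.inner x (A x (leftFrame e i x)) (leftFrame e j x)) (by
      have hk2 := congrArg (fun w ↦ (2 : ℂ) • w) hk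
      rw [smul_smul, show (2 : ℂ) * (1 / 2) = 1 by norm_num, one_smul, ← Matrix.smul_mulVec,
        ← sub_eq_zero, ← Matrix.sub_mulVec] at hk2
      rw [← hk2, Finset.smul_sum, ← Finset.sum_sub_distrib]
      congr 1
      refine Finset.sum_congr rfl fun j _ ↦ ?_
      push_cast
      module)
  have hj := fun j ↦ sub_eq_zero.1 (congrFun hz j)
  exact ⟨hj 0, hj 1, hj 2⟩

/-- The symmetric matrix `a` commutes with the Ricci matrix of the metric connection with
Christoffel symbols `2 ∑ₗ εⱼₖₗ aᵢₗ`. -/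
theorem commute_ricci_of_christoffel {a : Fin 3 → Fin 3 → ℝ} (ha : ∀ i j, a i j = a j i)
    {Γ : Fin 3 → Fin 3 → Fin 3 → ℝ} (hΓ : ∀ i j k, Γ i k j = -Γ i j k)
    (h12 : ∀ i, Γ i 1 2 = 2 * a i 0) (h02 : ∀ i, -Γ i 0 2 = 2 * a i 1)
    (h01 : ∀ i, Γ i 0 1 = 2 * a i 2) (i n : Fin 3) :
    ∑ m, (∑ j, frameCurvature Γ i j j m) * a m n =
      ∑ m, a i m * ∑ j, frameCurvature Γ m j j n := by
  have h00 : ∀ i j, Γ i j j = 0 := fun i j ↦ by linarith [hΓ i j j]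
  have h02' : ∀ i, Γ i 0 2 = -(2 * a i 1) := fun i ↦ by linarith [h02 i]
  have h21 : ∀ i, Γ i 2 1 = -(2 * a i 0) := fun i ↦ by rw [hΓ, h12]
  have h20 : ∀ i, Γ i 2 0 = 2 * a i 1 := fun i ↦ by rw [hΓ, h02]
  have h10 : ∀ i, Γ i 1 0 = -(2 * a i 2) := fun i ↦ by rw [hΓ, h01]
  -- Symmetry is used to keep only the entries on or above the diagonal; each of the nine matrix
  -- entries is then a polynomial identity in six variables.
  have s10 := ha 1 0
  have s20 := ha 2 0
  have s21 := ha 2 1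
  simp only [frameCurvature, Fin.sum_univ_three]
  fin_cases i <;> fin_cases n <;>
    simp only [Fin.zero_eta, Fin.mk_one, Fin.reduceFinMk, h00, h12, h02', h01, h21, h20, h10, s10,
      s20, s21] <;>
    ring

end Spinor

/-! ### Commutation on the frame and by linearity -/

theorem theorem4p4
    {E : Type*} [NormedAddCommGroup E] [NormedSpace ℝ E] [FiniteDimensional ℝ E]
    (hdim : Module.finrank ℝ E = 3)
    {G : Type*} [TopologicalSpace G] [ChartedSpace E G] [Group G] [LieGroup 𝓘(ℝ, E) ∞ G]
    (o : Orientation ℝ (GroupLieAlgebra 𝓘(ℝ, E) G) (Fin 3))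
    (g : ContMDiffRiemannianMetric 𝓘(ℝ, E) ∞ E (fun x : G ↦ TangentSpace 𝓘(ℝ, E) x))
    (hg : IsLeftInvariantMetric g)
    (e : Module.Basis (Fin 3) ℝ (GroupLieAlgebra 𝓘(ℝ, E) G))
    (he : IsOrientedOrthonormal g o e)
    (ψ : G → SpinorModule) (hψ : ψ ≠ 0) (hinv : IsInvariantSpinor ψ)
    (A : Π x : G, TangentSpace 𝓘(ℝ, E) x →L[ℝ] TangentSpace 𝓘(ℝ, E) x)
    (hA : IsGeneralisedKillingSpinor g e ψ A) (x : G) :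
    (A x).comp (ricciEndomorphism g e x) = (ricciEndomorphism g e x).comp (A x) := by
  set a : Fin 3 → Fin 3 → ℝ := fun i j ↦ g.inner x (A x (leftFrame e i x)) (leftFrame e j x)
  have hAF : ∀ i, A x (leftFrame e i x) = ∑ m, a i m • leftFrame e m x := fun i ↦
    (sum_inner_leftFrame hg he x _).symm
  have hRF : ∀ i, ricciEndomorphism g e x (leftFrame e i x) =
      ∑ m, (∑ j, frameCurvature (frameChristoffel g e) i j j m) • leftFrame e m x := fun i ↦ by
    simp only [← inner_ricciEndomorphism_leftFrame hg he _ _ x]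
    exact (sum_inner_leftFrame hg he x _).symm
  have hk := frameChristoffel_of_killing hg he hψ hinv hA x
  -- The symbols `Γ` are constants taken at the identity, whereas `a` is the matrix of `A` at `x`;
  -- the Killing equation at `x` links them, so constancy of `A` is not needed.
  have hcomm := commute_ricci_of_christoffel (a := a) (Γ := frameChristoffel g e)
    (fun i j ↦ (hA.symmetric x _ _).trans (g.symm x _ _))
    (frameChristoffel_antisymm hg he) (fun i ↦ (hk i).1) (fun i ↦ (hk i).2.1)
    (fun i ↦ (hk i).2.2)
  have hF : ∀ i, (A x) (ricciEndomorphism g e x (leftFrame e i x)) =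
      (ricciEndomorphism g e x) (A x (leftFrame e i x)) := fun i ↦ by
    refine ext_inner_leftFrame hg he fun n ↦ ?_
    rw [hRF, hAF]
    simp only [map_sum, map_smul, hAF, hRF, sum_apply, _root_.smul_apply, smul_eq_mul,
      inner_leftFrame hg he, mul_ite, mul_one, mul_zero, Finset.sum_ite_eq', Finset.mem_univ,
      if_true]
    exact hcomm i n
  ext v
  rw [← sum_inner_leftFrame hg he x v]
  simp only [map_sum, map_smul, ContinuousLinearMap.comp_apply, hF]
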